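/- Let $\mathcal{H}=\{z\in\mathbb{C}\mid \operatorname{Im} z>0\}$ and let $\mathrm{Hol}$ be the $\mathbb{C}$-algebra of holomorphic functions on $\mathcal{H}$. Let $E_k=1+O(q)$, $q=e^{2\pi i z}$, be the normalised Eisenstein series of weight $k$ on $\mathrm{SL}(2,\mathbb{Z})$, and for $n\in\mathbb{R}$ let $D_n f=\frac{1}{2\pi i}\frac{df}{dz}-\frac{n}{12}E_2f$ be the Ramanujan–Serre operator. Let $H=\bigoplus_{n\in\mathbb{R}}H_n$, where each $H_n$ is a copy of $\mathrm{Hol}$, with elements written $(f,n)$; $H$ is a graded $\mathbb{C}$-algebra under $(f,n)(g,m)=(fg,n+m)$. Define $\mathbb{C}$-linear endomorphisms of $H$ by $$\delta(f,n)=(D_nf,n+2),\qquad e_4(f,n)=(E_4f,n+4),\qquad e_6(f,n)=(E_6f,n+6).$$ Let $\mathcal{R}\subset\mathrm{End}_{\mathbb{C}}(H)$ be the $\mathbb{C}$-subalgebra generated by $\delta,e_4,e_6$ (the algebra of modular linear differential operators), and for $i\in\mathbb{Z}$ let $\mathcal{R}_i$ be the set of $a\in\mathcal{R}$ with $a(H_n)\subset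 H_{n+i}$ for all $n\in\mathbb{R}$. Let $\mathcal{M}=\bigoplus_{k}\mathcal{M}_k$ be the graded algebra of holomorphic modular forms on $\mathrm{SL}(2,\mathbb{Z})$, and let $\delta$ also denote the derivation of $\mathcal{M}$ given by $D_k:\mathcal{M}_k\to\mathcal{M}_{k+2}$ on $\mathcal{M}_k$. Let $\mathcal{M}[\xi;1,\delta]$ be the skew polynomial (Ore) ring: its elements are the finite sums $\sum_i a_i\xi^i$ with uniquely determined $a_i\in\mathcal{M}$, and its multiplication is determined by $\xi a=a\xi+\delta(a)$ for $a\in\mathcal{M}$. Give elements of $\mathcal{M}_k$ weight $k$ and $\xi$ weight $2$. **Theorem.** The algebra $\mathcal{M}=\mathbb{C}[E_4,E_6]$ is the polynomial ring in $E_4$ and $E_6$, and $\mathcal{M}[\xi;1,\delta]$ is a graded $\mathbb{C}$-algebra with respect to the weights above. There is an isomorphism of $\mathbb{C}$-algebras $\mathcal{M}[\xi;1,\delta]\to\mathcal{R}$ that sends $E_4,E_6,\xi$ to $e_4,e_6,\delta$ respectively, and under which, for every $n\in\mathbb{Z}$, the part of weight $n$ corresponds to $\mathcal{R}_n$. Moreover,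 $\mathcal{R}$ is left and right Noetherian, and it is a left and right Ore domain. -/

import Mathlib

open scoped UpperHalfPlane MatrixGroups ModularForm Manifold DirectSum

/-! ### The skew polynomial ring `A[ξ; 1, d]` -/

section SkewPolynomials

variable {k A : Type*} [CommRing k] [CommRing A] [Algebra k A]

/-- The skew polynomial ring `A[ξ; 1, d]` of a derivation `d` of a commutative `k`-algebra `A`:
finite sums `∑ aᵢ ξ ^ i`, stored by their coefficients `i ↦ aᵢ`, with the multiplication
determined by `ξ a = a ξ + d a`. -/
def SkewPolynomialRing (_d : Derivation k A A) : Type _ := ℕ →₀ A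

namespace SkewPolynomialRing

variable (d : Derivation k A A)

noncomputable instance : AddCommGroup (SkewPolynomialRing d) :=
  inferInstanceAs (AddCommGroup (ℕ →₀ A))

noncomputable instance : Module A (SkewPolynomialRing d) :=
  inferInstanceAs (Module A (ℕ →₀ A))

noncomputable instance : Module k (SkewPolynomialRing d) :=
  inferInstanceAs (Module k (ℕ →₀ A))

instance : IsScalarTower k A (SkewPolynomialRing d) :=
  inferInstanceAs (IsScalarTower k A (ℕ →₀ A))

/-- The element `a ξ ^ i`. -/
noncomputable def monomial (i : ℕ) (a : A) : SkewPolynomialRing d :=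
  (Finsupp.single i a : ℕ →₀ A)

/-- The coefficient of `ξ ^ i`. -/
def coeff (i : ℕ) : SkewPolynomialRing d →ₗ[A] A :=
  (Finsupp.lapply i : (ℕ →₀ A) →ₗ[A] A)

/-- Left multiplication by `ξ`, that is `∑ bⱼ ξ ^ j ↦ ∑ (bⱼ ξ ^ (j + 1) + d bⱼ ξ ^ j)`. -/
noncomputable def xiMul : SkewPolynomialRing d →ₗ[k] SkewPolynomialRing d :=
  (Finsupp.lmapDomain A k (· + 1) + Finsupp.mapRange.linearMap d.toLinearMap :
    (ℕ →₀ A) →ₗ[k] (ℕ →₀ A))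

/-- `(∑ aᵢ ξ ^ i) * q = ∑ aᵢ • ξ ^ i q`. -/
noncomputable instance : Mul (SkewPolynomialRing d) where
  mul p q := Finsupp.sum (show ℕ →₀ A from p) fun i a ↦ a • (xiMul d ^ i) q

noncomputable instance : One (SkewPolynomialRing d) where
  one := monomial d 0 1

variable {d}

theorem mul_def (p q : SkewPolynomialRing d) :
    p * q = Finsupp.sum (show ℕ →₀ A from p) fun i a ↦ a • (xiMul d ^ i) q := rfl

theorem one_def : (1 : SkewPolynomialRing d) = monomial d 0 1 := rfl

theorem induction_on {P : SkewPolynomialRing d → Prop} (p : SkewPolynomialRing d)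
    (h0 : P 0) (hadd : ∀ p q, P p → P q → P (p + q)) (hm : ∀ i a, P (monomial d i a)) : P p :=
  Finsupp.induction_linear (motive := P) p h0 hadd hm

theorem xiMul_monomial (i : ℕ) (a : A) :
    xiMul d (monomial d i a) = monomial d (i + 1) a + monomial d i (d a) := by
  change (Finsupp.lmapDomain A k (· + 1) + Finsupp.mapRange.linearMap d.toLinearMap :
    (ℕ →₀ A) →ₗ[k] (ℕ →₀ A)) (Finsupp.single i a) = _
  rw [LinearMap.add_apply]
  simp [monomial]
  rfl

theorem smul_monomial (a : A) (i : ℕ) (b : A) : a • monomial d i b = monomial d i (a * b) := by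
  change a • (Finsupp.single i b : ℕ →₀ A) = Finsupp.single i (a * b)
  simp

theorem monomial_add (i : ℕ) (a b : A) :
    monomial d i (a + b) = monomial d i a + monomial d i b :=
  Finsupp.single_add i a b

theorem monomial_zero (i : ℕ) : monomial d i 0 = 0 := Finsupp.single_zero i

theorem xiMul_smul (a : A) (p : SkewPolynomialRing d) :
    xiMul d (a • p) = a • xiMul d p + d a • p := by
  induction p using induction_on with
  | h0 => simp
  | hadd p q hp hq => simp only [smul_add, map_add, hp, hq]; abel
  | hm i b =>
    simp only [smul_monomial, xiMul_monomial, smul_add, Derivation.leibniz, smul_eq_mul,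
      monomial_add, mul_comm b]
    abel

theorem add_mul' (p q r : SkewPolynomialRing d) : (p + q) * r = p * r + q * r :=
  Finsupp.sum_add_index' (by simp) (by simp [add_smul])

theorem mul_add' (p q r : SkewPolynomialRing d) : p * (q + r) = p * q + p * r := by
  simp only [mul_def, map_add, smul_add]
  exact Finsupp.sum_add

theorem zero_mul' (p : SkewPolynomialRing d) : 0 * p = 0 := Finsupp.sum_zero_index

theorem mul_zero' (p : SkewPolynomialRing d) : p * 0 = 0 := by
  simp only [mul_def, map_zero, smul_zero]
  exact Finset.sum_const_zero

theorem monomial_mul (i : ℕ) (a : A) (q : SkewPolynomialRing d) :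
    monomial d i a * q = a • (xiMul d ^ i) q :=
  Finsupp.sum_single_index (by simp)

theorem smul_mul' (a : A) (p q : SkewPolynomialRing d) : (a • p) * q = a • (p * q) := by
  induction p using induction_on with
  | h0 => simp [zero_mul']
  | hadd p p' hp hp' => simp only [smul_add, add_mul', hp, hp']
  | hm i b => simp only [smul_monomial, monomial_mul, mul_smul]

theorem xiMul_mul (p q : SkewPolynomialRing d) : xiMul d p * q = xiMul d (p * q) := by
  induction p using induction_on with
  | h0 => simp [zero_mul']
  | hadd p p' hp hp' => simp only [map_add, add_mul', hp, hp']
  | hm i b =>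
    simp only [xiMul_monomial, add_mul', monomial_mul, xiMul_smul, pow_succ', Module.End.mul_apply]

theorem xiMul_pow_mul (i : ℕ) (p q : SkewPolynomialRing d) :
    (xiMul d ^ i) p * q = (xiMul d ^ i) (p * q) := by
  induction i with
  | zero => simp
  | succ i ih => simp only [pow_succ', Module.End.mul_apply, xiMul_mul, ih]

theorem mul_assoc' (p q r : SkewPolynomialRing d) : p * q * r = p * (q * r) := by
  induction p using induction_on with
  | h0 => simp [zero_mul']
  | hadd p p' hp hp' => simp only [add_mul', hp, hp']
  | hm i b => simp only [monomial_mul, smul_mul', xiMul_pow_mul]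

theorem xiMul_pow_one (i : ℕ) : (xiMul d ^ i) 1 = monomial d i 1 := by
  induction i with
  | zero => rfl
  | succ i ih =>
    rw [pow_succ', Module.End.mul_apply, ih, xiMul_monomial, Derivation.map_one_eq_zero,
      monomial_zero, add_zero]

theorem mul_one' (p : SkewPolynomialRing d) : p * 1 = p := by
  induction p using induction_on with
  | h0 => simp [zero_mul']
  | hadd p p' hp hp' => simp only [add_mul', hp, hp']
  | hm i b => simp only [monomial_mul, xiMul_pow_one, smul_monomial, mul_one]

theorem one_mul' (p : SkewPolynomialRing d) : 1 * p = p := by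
  simp [one_def, monomial_mul]

noncomputable instance : Ring (SkewPolynomialRing d) :=
  { (inferInstance : AddCommGroup (SkewPolynomialRing d)),
    (inferInstance : Mul (SkewPolynomialRing d)),
    (inferInstance : One (SkewPolynomialRing d)) with
    left_distrib := mul_add'
    right_distrib := add_mul'
    zero_mul := zero_mul'
    mul_zero := mul_zero'
    mul_assoc := mul_assoc'
    one_mul := one_mul'
    mul_one := mul_one' }

theorem mul_smul' (c : k) (p q : SkewPolynomialRing d) : p * (c • q) = c • (p * q) := by
  induction p using induction_on with
  | h0 => simp
  | hadd p p' hp hp' => simp only [add_mul, hp, hp', smul_add]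
  | hm i b => simp only [monomial_mul, map_smul, smul_comm b c]

noncomputable instance : Algebra k (SkewPolynomialRing d) :=
  Algebra.ofModule
    (fun c p q ↦ by rw [← algebraMap_smul A c p, smul_mul', algebraMap_smul])
    mul_smul'

variable (d)

/-- The inclusion of the coefficients. -/
noncomputable def C : A →ₐ[k] SkewPolynomialRing d :=
  AlgHom.ofLinearMap (Finsupp.lsingle 0 : A →ₗ[k] (ℕ →₀ A)) rfl fun a b ↦ by
    change monomial d 0 (a * b) = monomial d 0 a * monomial d 0 b
    simp [monomial_mul, smul_monomial]

/-- The variable `ξ`. -/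
noncomputable def xi : SkewPolynomialRing d := monomial d 1 1

theorem xi_mul_C (a : A) : xi d * C d a = C d a * xi d + C d (d a) := by
  change monomial d 1 1 * monomial d 0 a = monomial d 0 a * monomial d 1 1 + monomial d 0 (d a)
  simp [monomial_mul, xiMul_monomial, smul_monomial]

theorem C_mul_xi_pow (a : A) (i : ℕ) : C d a * xi d ^ i = monomial d i a := by
  have h : ∀ i : ℕ, xi d ^ i = monomial d i 1 := by
    intro i
    induction i with
    | zero => rfl
    | succ i ih =>
      rw [pow_succ', ih, xi, monomial_mul, pow_one, xiMul_monomial, Derivation.map_one_eq_zero,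
        monomial_zero, add_zero, one_smul]
  change monomial d 0 a * _ = _
  simp [h, monomial_mul, smul_monomial]

/-- The weight decomposition of the graded skew polynomial ring `A[ξ; 1, d]`, when
`A = ⨁ 𝒜 n` and `d` raises weights by `m`: elements of `𝒜 n` have weight `n` and `ξ` has
weight `m`. -/
def weightPiece (𝒜 : ℤ → Submodule k A) (m n : ℤ) : Submodule k (SkewPolynomialRing d) where
  carrier := {p | ∀ i : ℕ, coeff d i p ∈ 𝒜 (n - i * m)}
  zero_mem' i := by simp
  add_mem' hp hq i := by simpa using add_mem (hp i) (hq i)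
  smul_mem' c p hp i := (𝒜 (n - i * m)).smul_mem c (hp i)

end SkewPolynomialRing

end SkewPolynomials

/-! ### Left and right Ore domains -/

/-- A left Ore domain: a domain whose nonzero elements form a left Ore set. -/
def IsLeftOreDomain (R : Type*) [Ring R] : Prop :=
  IsDomain R ∧ Nonempty (OreLocalization.OreSet (nonZeroDivisors R))

/-- A right Ore domain: a ring whose opposite is a left Ore domain. -/
def IsRightOreDomain (R : Type*) [Ring R] : Prop :=
  IsLeftOreDomain Rᵐᵒᵖ

/-! ### Modular linear differential operators -/

namespace MLDO

/-- The holomorphic functions on the upper half plane, as an algebra under pointwise operations. -/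
def holSubalgebra : Subalgebra ℂ (ℍ → ℂ) where
  carrier := {f | MDiff f}
  mul_mem' hf hg := MDifferentiable.mul hf hg
  add_mem' hf hg := MDifferentiable.add hf hg
  algebraMap_mem' _ := mdifferentiable_const

/-- The algebra `Hol` of holomorphic functions on the upper half plane, as a type. -/
def Hol : Type := holSubalgebra

noncomputable instance : CommRing Hol := inferInstanceAs (CommRing holSubalgebra)

noncomputable instance : Algebra ℂ Hol := inferInstanceAs (Algebra ℂ holSubalgebra)

/-- The Ramanujan-Serre operator `f ↦ f' - (n / 12) E₂ f` on holomorphic functions, where `f'`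
is the derivative of `f` divided by `2 π i`. -/
noncomputable def serreHol (n : ℝ) : Hol →ₗ[ℂ] Hol where
  toFun f := ⟨Derivative.serreDerivative n f.1,
    Derivative.serreDerivative_mdifferentiable _ f.2⟩
  map_add' f g := Subtype.ext (Derivative.serreDerivative_add _ _ _ f.2 g.2)
  map_smul' c f := Subtype.ext (Derivative.serreDerivative_smul _ c _ f.2)

/-- A modular form, as a holomorphic function. -/
def toHol {k : ℤ} (f : ModularForm 𝒮ℒ k) : Hol := ⟨f, f.holo'⟩

/-- The graded algebra `H = ⨁_{n ∈ ℝ} Hol`, with `(f, n) (g, m) = (f g, n + m)`. -/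
def H : Type := ⨁ _ : ℝ, Hol

noncomputable instance : CommRing H := inferInstanceAs (CommRing (⨁ _ : ℝ, Hol))

noncomputable instance : Algebra ℂ H := inferInstanceAs (Algebra ℂ (⨁ _ : ℝ, Hol))

/-- The element `(f, n)` of `H`. -/
noncomputable def ofWeight (n : ℝ) : Hol →ₗ[ℂ] H :=
  (DirectSum.lof ℂ ℝ (fun _ ↦ Hol) n : Hol →ₗ[ℂ] ⨁ _ : ℝ, Hol)

theorem ofWeight_mul_ofWeight (n m : ℝ) (f g : Hol) :
    ofWeight n f * ofWeight m g = ofWeight (n + m) (f * g) :=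
  DirectSum.of_mul_of (A := fun _ : ℝ ↦ Hol) f g

/-- The endomorphism `(f, n) ↦ (φₙ f, n + i)` of `H`. -/
noncomputable def homogeneousEnd (i : ℝ) (φ : ℝ → Hol →ₗ[ℂ] Hol) : Module.End ℂ H :=
  (DirectSum.toModule ℂ ℝ H fun n ↦ ofWeight (n + i) ∘ₗ φ n : (⨁ _ : ℝ, Hol) →ₗ[ℂ] H)

theorem homogeneousEnd_ofWeight (i : ℝ) (φ : ℝ → Hol →ₗ[ℂ] Hol) (n : ℝ) (f : Hol) :
    homogeneousEnd i φ (ofWeight n f) = ofWeight (n + i) (φ n f) :=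
  DirectSum.toModule_lof ℂ (M := fun _ : ℝ ↦ Hol) n f

/-- `δ (f, n) = (Dₙ f, n + 2)`. -/
noncomputable def delta : Module.End ℂ H := homogeneousEnd 2 serreHol

/-- `e₄ (f, n) = (E₄ f, n + 4)`. -/
noncomputable def e₄ : Module.End ℂ H :=
  homogeneousEnd 4 fun _ ↦ LinearMap.mulLeft ℂ (toHol ModularForm.E₄)

/-- `e₆ (f, n) = (E₆ f, n + 6)`. -/
noncomputable def e₆ : Module.End ℂ H :=
  homogeneousEnd 6 fun _ ↦ LinearMap.mulLeft ℂ (toHol ModularForm.E₆)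

/-- The endomorphisms of `H` of weight `i`: those mapping `Hₙ` into `Hₙ₊ᵢ` for all `n`. -/
def endWeight (i : ℝ) : Submodule ℂ (Module.End ℂ H) where
  carrier := {φ | ∀ (n : ℝ) (f : Hol), φ (ofWeight n f) ∈ LinearMap.range (ofWeight (n + i))}
  zero_mem' _ _ := by simp
  add_mem' hφ hψ n f := add_mem (hφ n f) (hψ n f)
  smul_mem' c _ hφ n f := Submodule.smul_mem _ c (hφ n f)

/-- The MLDO algebra `ℛ`, generated by `δ`, `e₄` and `e₆`. -/
noncomputable def mldoAlgebra : Subalgebra ℂ (Module.End ℂ H) :=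
  Algebra.adjoin ℂ {delta, e₄, e₆}

/-- The space `ℛᵢ` of modular linear differential operators of weight `i`. -/
noncomputable def mldoWeight (i : ℤ) : Submodule ℂ mldoAlgebra :=
  (endWeight i).comap mldoAlgebra.val.toLinearMap

/-! ### The algebra of modular forms and its Ramanujan-Serre derivation -/

open UpperHalfPlane in
theorem isBoundedAtImInfty_normalizedDeriv {f : ℍ → ℂ} (hf : MDiff f)
    (hb : IsBoundedAtImInfty f) :
    IsBoundedAtImInfty (Derivative.normalizedDerivOfComplex f) := by
  rw [isBoundedAtImInfty_iff] at hb ⊢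
  obtain ⟨M, B, hMB⟩ := hb
  refine ⟨‖(2 * Real.pi * Complex.I : ℂ)⁻¹‖ * (M / (1 / 2)), max B 0 + 1, fun z hz ↦ ?_⟩
  rw [Derivative.normalizedDerivOfComplex, norm_mul]
  have him : ∀ w ∈ Metric.closedBall (z : ℂ) (1 / 2), max B 0 < w.im := by
    intro w hw
    have h1 : |(w - z).im| ≤ 1 / 2 :=
      (Complex.abs_im_le_norm _).trans (by simpa [dist_eq_norm] using hw)
    have h2 := (abs_le.mp h1).1
    rw [Complex.sub_im, coe_im] at h2
    linarith
  have hd : DifferentiableOn ℂ (f ∘ ofComplex) upperHalfPlaneSet :=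
    UpperHalfPlane.mdifferentiable_iff.mp hf
  have hsub : Metric.closedBall (z : ℂ) (1 / 2) ⊆ upperHalfPlaneSet := fun w hw ↦
    lt_of_le_of_lt (le_max_right _ _) (him w hw)
  refine mul_le_mul_of_nonneg_left ?_ (norm_nonneg _)
  refine Complex.norm_deriv_le_of_forall_mem_sphere_norm_le (by norm_num) ?_ fun w hw ↦ ?_
  · refine (hd.mono ?_).diffContOnCl
    rwa [closure_ball _ (by norm_num)]
  · have hw' := Metric.sphere_subset_closedBall hw
    have hpos : 0 < w.im := lt_of_le_of_lt (le_max_right _ _) (him w hw')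
    rw [Function.comp_apply, ofComplex_apply_of_im_pos hpos]
    exact hMB _ (le_trans (le_max_left _ _) (him w hw').le)

theorem isBoundedAtImInfty_serreDerivative (n : ℂ) {f : ℍ → ℂ} (hf : MDiff f)
    (hb : UpperHalfPlane.IsBoundedAtImInfty f) :
    UpperHalfPlane.IsBoundedAtImInfty (Derivative.serreDerivative n f) := by
  have h := (isBoundedAtImInfty_normalizedDeriv hf hb).sub
    ((EisensteinSeries.isBoundedAtImInfty_E2.mul hb).const_mul_left (n * 12⁻¹))
  refine h.congr_left fun z ↦ ?_
  simp [mul_assoc]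

/-- The Ramanujan-Serre operator maps modular forms of weight `k` to modular forms of
weight `k + 2`. -/
noncomputable def serreForm (k : ℤ) : ModularForm 𝒮ℒ k →ₗ[ℂ] ModularForm 𝒮ℒ (k + 2) where
  toFun f :=
    { toFun := Derivative.serreDerivative k f
      slash_action_eq' := by
        rintro _ ⟨γ, rfl⟩
        exact Derivative.serreDerivative_slash_invariant f.holo'
          (f.slash_action_eq' _ ⟨γ, rfl⟩)
      holo' := Derivative.serreDerivative_mdifferentiable _ f.holo'
      bdd_at_cusps' := by
        intro c hc
        rw [OnePoint.isBoundedAt_iff_forall_SL2Z hc]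
        intro γ _
        have h : (f : ℍ → ℂ) ∣[k] γ = f := f.slash_action_eq' _ ⟨γ, rfl⟩
        have h' : Derivative.serreDerivative k f ∣[k + 2] γ = Derivative.serreDerivative k f :=
          Derivative.serreDerivative_slash_invariant f.holo' h
        change UpperHalfPlane.IsBoundedAtImInfty (Derivative.serreDerivative k f ∣[k + 2] γ)
        rw [h']
        exact isBoundedAtImInfty_serreDerivative _ f.holo' (ModularFormClass.bdd_at_infty f) }
  map_add' f g := DFunLike.coe_injective
    (Derivative.serreDerivative_add _ _ _ f.holo' g.holo')
  map_smul' c f := DFunLike.coe_injective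
    (Derivative.serreDerivative_smul _ c _ f.holo')

/-- The graded algebra `ℳ` of modular forms on `SL(2, ℤ)`, the direct sum of the spaces of
modular forms of weight `k` (which vanish for odd `k`). -/
abbrev ModularFormAlgebra : Type := ⨁ k : ℤ, ModularForm 𝒮ℒ k

/-- A modular form of weight `k`, as an element of `ℳ`. -/
noncomputable def ofForm (k : ℤ) : ModularForm 𝒮ℒ k →ₗ[ℂ] ModularFormAlgebra :=
  DirectSum.lof ℂ ℤ (fun k ↦ ModularForm 𝒮ℒ k) k

/-- The homogeneous part of weight `k` of `ℳ`. -/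
noncomputable def formWeight (k : ℤ) : Submodule ℂ ModularFormAlgebra :=
  LinearMap.range (ofForm k)

/-- The linear map on `ℳ` that acts on modular forms of weight `k` by `D_k`. -/
noncomputable def serreLinear : ModularFormAlgebra →ₗ[ℂ] ModularFormAlgebra :=
  DirectSum.toModule ℂ ℤ ModularFormAlgebra fun k ↦ ofForm (k + 2) ∘ₗ serreForm k

theorem serreLinear_ofForm (k : ℤ) (f : ModularForm 𝒮ℒ k) :
    serreLinear (ofForm k f) = ofForm (k + 2) (serreForm k f) :=
  DirectSum.toModule_lof ℂ k f

theorem ofForm_mul_ofForm {k l : ℤ} (f : ModularForm 𝒮ℒ k) (g : ModularForm 𝒮ℒ l) :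
    ofForm k f * ofForm l g = ofForm (k + l) (f.mul g) :=
  DirectSum.of_mul_of f g

theorem ofForm_eq_ofForm {k l : ℤ} (h : k = l) (f : ModularForm 𝒮ℒ k) (g : ModularForm 𝒮ℒ l)
    (hfg : (f : ℍ → ℂ) = g) : ofForm k f = ofForm l g := by
  subst h
  rw [DFunLike.coe_injective hfg]

theorem serreLinear_leibniz (a b : ModularFormAlgebra) :
    serreLinear (a * b) = a • serreLinear b + b • serreLinear a := by
  simp only [smul_eq_mul]
  induction a using DirectSum.induction_on with
  | zero => simp
  | add a a' ha ha' => simp only [add_mul, map_add, mul_add, ha, ha']; abel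
  | of k f =>
    induction b using DirectSum.induction_on with
    | zero => simp
    | add b b' hb hb' => simp only [add_mul, map_add, mul_add, hb, hb']; abel
    | of l g =>
      change serreLinear (ofForm k f * ofForm l g) =
        ofForm k f * serreLinear (ofForm l g) + ofForm l g * serreLinear (ofForm k f)
      rw [ofForm_mul_ofForm, serreLinear_ofForm, serreLinear_ofForm, serreLinear_ofForm,
        ofForm_mul_ofForm, ofForm_mul_ofForm,
        ofForm_eq_ofForm (by ring) (f.mul (serreForm l g))
          (ModularForm.mcast (by ring) (f.mul (serreForm l g)) : ModularForm 𝒮ℒ (k + l + 2)) rfl,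
        ofForm_eq_ofForm (by ring) (g.mul (serreForm k f))
          (ModularForm.mcast (by ring) (g.mul (serreForm k f)) : ModularForm 𝒮ℒ (k + l + 2)) rfl,
        ← map_add]
      congr 1
      refine DFunLike.coe_injective ?_
      have h := Derivative.serreDerivative_mul k l f g f.holo' g.holo'
      have h' : Derivative.serreDerivative ((k + l : ℤ) : ℂ) ((f : ℍ → ℂ) * g) =
          (f : ℍ → ℂ) * Derivative.serreDerivative l g +
            (g : ℍ → ℂ) * Derivative.serreDerivative k f := by
        push_cast
        rw [h]
        ring
      exact h'

/-- The derivation `δ` of `ℳ`, acting on modular forms of weight `k` by `D_k`. -/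
noncomputable def serreDerivation : Derivation ℂ ModularFormAlgebra ModularFormAlgebra :=
  Derivation.mk' serreLinear serreLinear_leibniz

/-- The Eisenstein series `E₄` as an element of `ℳ`. -/
noncomputable def formE₄ : ModularFormAlgebra := ofForm 4 ModularForm.E₄

/-- The Eisenstein series `E₆` as an element of `ℳ`. -/
noncomputable def formE₆ : ModularFormAlgebra := ofForm 6 ModularForm.E₆

end MLDO

/-!
The elements of `A[ξ; 1, d]` of degree at most `n` in `ξ` have leading forms in `A[X]`, so Hilbert's
basis theorem bounds the chains of left ideals; right ideals reduce to left ideals because the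
opposite ring is a quotient of `A[ξ; 1, -d]`. A Noetherian domain is an Ore domain.

Every modular form of even weight at least `4` is a multiple of the discriminant plus a scalar
multiple of a monomial in `E₄` and `E₆`, so these generate `ℳ`. They are algebraically independent
because `E₆` vanishes at `i` while `E₄` does not: the characters `f ↦ f(i) t ^ k` of `ℳ` send `E₆`
to `0` and `E₄` to an arbitrary nonzero number, so `E₆` divides no nonzero polynomial in `E₄`.

The operator `δ` is a derivation of `H`, so `ℳ[ξ; 1, δ]` acts on `H` through `H[ξ; 1, δ]`. The
latter acts faithfully: `δ(z, 0) = (1 / (2πi), 2)` is a unit of `H`, so the commutator with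
multiplication by `(z, 0)` lowers the degree of a differential operator by exactly one.
-/

namespace SkewPolynomialRing

section Coefficients

variable {k A : Type*} [CommRing k] [CommRing A] [Algebra k A] {d : Derivation k A A}

@[ext]
theorem ext {p q : SkewPolynomialRing d} (h : ∀ i, coeff d i p = coeff d i q) : p = q :=
  Finsupp.ext h

theorem coeff_monomial (i j : ℕ) (a : A) :
    coeff d i (monomial d j a) = if j = i then a else 0 :=
  Finsupp.single_apply

theorem coeff_smul (i : ℕ) (a : A) (p : SkewPolynomialRing d) :
    coeff d i (a • p) = a * coeff d i p :=
  map_smul (coeff d i) a p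

theorem coeff_C (i : ℕ) (a : A) : coeff d i (C d a) = if 0 = i then a else 0 :=
  coeff_monomial i 0 a

theorem coeff_C_zero (a : A) : coeff d 0 (C d a) = a := by rw [coeff_C, if_pos rfl]

theorem coeff_xiMul_zero (p : SkewPolynomialRing d) :
    coeff d 0 (xiMul d p) = d (coeff d 0 p) := by
  induction p using induction_on with
  | h0 => simp
  | hadd p q hp hq => simp only [map_add, hp, hq]
  | hm i a =>
    rw [xiMul_monomial, map_add, coeff_monomial, coeff_monomial, coeff_monomial]
    split_ifs <;> simp_all

theorem coeff_xiMul_succ (i : ℕ) (p : SkewPolynomialRing d) :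
    coeff d (i + 1) (xiMul d p) = coeff d i p + d (coeff d (i + 1) p) := by
  induction p using induction_on with
  | h0 => simp
  | hadd p q hp hq => simp only [map_add, hp, hq]; abel
  | hm j a =>
    rw [xiMul_monomial, map_add, coeff_monomial, coeff_monomial, coeff_monomial, coeff_monomial]
    split_ifs <;> simp_all

theorem C_mul (a : A) (p : SkewPolynomialRing d) : C d a * p = a • p :=
  (monomial_mul 0 a p).trans (by rw [pow_zero, Module.End.one_apply])

theorem xi_mul (p : SkewPolynomialRing d) : xi d * p = xiMul d p := by
  rw [xi, monomial_mul, pow_one, one_smul]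

instance : IsScalarTower A (SkewPolynomialRing d) (SkewPolynomialRing d) := ⟨smul_mul'⟩

theorem eq_top_of_C_mem_of_xi_mem {T : Subalgebra k (SkewPolynomialRing d)}
    (hC : ∀ a, C d a ∈ T) (hxi : xi d ∈ T) : T = ⊤ := by
  refine Algebra.eq_top_iff.mpr fun p ↦ ?_
  induction p using induction_on with
  | h0 => exact zero_mem T
  | hadd p q hp hq => exact add_mem hp hq
  | hm i a => rw [← C_mul_xi_pow]; exact mul_mem (hC a) (pow_mem hxi i)

end Coefficients

/-! ### Universal property and functoriality -/

section Lift

variable {k A B : Type*} [CommRing k] [CommRing A] [Algebra k A] [Ring B] [Algebra k B]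
  {d : Derivation k A A} (f : A →ₐ[k] B) (x : B)

/-- The linear map `∑ aᵢ ξ ^ i ↦ ∑ f aᵢ * x ^ i` underlying `SkewPolynomialRing.lift`. -/
noncomputable def liftLinear : SkewPolynomialRing d →ₗ[k] B :=
  (Finsupp.lsum k fun i ↦ LinearMap.mulRight k (x ^ i) ∘ₗ f.toLinearMap : (ℕ →₀ A) →ₗ[k] B)

theorem liftLinear_monomial (i : ℕ) (a : A) :
    liftLinear f x (monomial d i a) = f a * x ^ i :=
  Finsupp.lsum_single k (fun i ↦ LinearMap.mulRight k (x ^ i) ∘ₗ f.toLinearMap) i a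

theorem liftLinear_smul (a : A) (p : SkewPolynomialRing d) :
    liftLinear f x (a • p) = f a * liftLinear f x p := by
  induction p using induction_on with
  | h0 => simp
  | hadd p q hp hq => simp only [smul_add, map_add, hp, hq, mul_add]
  | hm i b => rw [smul_monomial, liftLinear_monomial, liftLinear_monomial, map_mul, mul_assoc]

variable {x} (hx : ∀ a, x * f a = f a * x + f (d a))
include hx

theorem liftLinear_xiMul (p : SkewPolynomialRing d) :
    liftLinear f x (xiMul d p) = x * liftLinear f x p := by
  induction p using induction_on with
  | h0 => simp
  | hadd p q hp hq => simp only [map_add, hp, hq, mul_add]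
  | hm i b =>
    rw [xiMul_monomial, map_add, liftLinear_monomial, liftLinear_monomial, liftLinear_monomial,
      ← mul_assoc, hx, pow_succ', ← mul_assoc, add_mul]

theorem liftLinear_xiMul_pow (i : ℕ) (p : SkewPolynomialRing d) :
    liftLinear f x ((xiMul d ^ i) p) = x ^ i * liftLinear f x p := by
  induction i with
  | zero => simp
  | succ i ih =>
    rw [pow_succ', Module.End.mul_apply, liftLinear_xiMul f hx, ih, pow_succ', mul_assoc]

theorem liftLinear_mul (p q : SkewPolynomialRing d) :
    liftLinear f x (p * q) = liftLinear f x p * liftLinear f x q := by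
  induction p using induction_on with
  | h0 => simp
  | hadd p p' hp hp' => simp only [add_mul, map_add, hp, hp']
  | hm i a =>
    rw [monomial_mul, liftLinear_smul, liftLinear_xiMul_pow f hx, liftLinear_monomial, mul_assoc]

/-- The universal property of `A[ξ; 1, d]`: an algebra map `f` on the coefficients extends, with
prescribed image `x` of `ξ`, as soon as `x` satisfies the commutation rule of `ξ`. -/
noncomputable def lift : SkewPolynomialRing d →ₐ[k] B :=
  AlgHom.ofLinearMap (liftLinear f x) (by rw [one_def, liftLinear_monomial]; simp)
    (liftLinear_mul f hx)

theorem lift_monomial (i : ℕ) (a : A) : lift f hx (monomial d i a) = f a * x ^ i :=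
  liftLinear_monomial f x i a

theorem lift_C (a : A) : lift f hx (C d a) = f a :=
  (lift_monomial f hx 0 a).trans (by simp)

theorem lift_xi : lift f hx (xi d) = x :=
  (lift_monomial f hx 1 1).trans (by simp)

end Lift

section Map

variable {k A B : Type*} [CommRing k] [CommRing A] [Algebra k A] [CommRing B] [Algebra k B]
  {d : Derivation k A A} {d' : Derivation k B B} (f : A →ₐ[k] B)
  (hf : ∀ a, f (d a) = d' (f a))

/-- The map `A[ξ; 1, d] → B[ξ; 1, d']` induced by a map of differential algebras. -/
noncomputable def map : SkewPolynomialRing d →ₐ[k] SkewPolynomialRing d' :=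
  lift ((C d').comp f) (x := xi d') fun a ↦ by
    rw [AlgHom.comp_apply, AlgHom.comp_apply, xi_mul_C, hf]

theorem map_monomial (i : ℕ) (a : A) : map f hf (monomial d i a) = monomial d' i (f a) :=
  (lift_monomial _ _ i a).trans (C_mul_xi_pow d' (f a) i)

theorem coeff_map (i : ℕ) (p : SkewPolynomialRing d) :
    coeff d' i (map f hf p) = f (coeff d i p) := by
  induction p using induction_on with
  | h0 => simp
  | hadd p q hp hq => simp only [map_add, hp, hq]
  | hm j a =>
    rw [map_monomial, coeff_monomial, coeff_monomial]
    split_ifs <;> simp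

theorem map_injective (hinj : Function.Injective f) : Function.Injective (map f hf) :=
  fun p q h ↦ ext fun i ↦ hinj (by rw [← coeff_map f hf, ← coeff_map f hf, h])

theorem map_C (a : A) : map f hf (C d a) = C d' (f a) := lift_C _ _ a

theorem map_xi : map f hf (xi d) = xi d' := lift_xi _ _

end Map

/-! ### Degrees -/

section Degree

variable {k A : Type*} [CommRing k] [CommRing A] [Algebra k A] {d : Derivation k A A}

variable (d) in
/-- The skew polynomials of degree less than `n`; a skew polynomial `p` of degree at most `n` is
written `p ∈ degreeLT d (n + 1)`, with leading coefficient `coeff d n p`. -/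
def degreeLT (n : ℕ) : Submodule A (SkewPolynomialRing d) where
  carrier := {p | ∀ i, n ≤ i → coeff d i p = 0}
  zero_mem' _ _ := map_zero _
  add_mem' hp hq i hi := by rw [map_add, hp i hi, hq i hi, add_zero]
  smul_mem' a p hp i hi := by rw [map_smul, hp i hi, smul_zero]

theorem degreeLT_mono {m n : ℕ} (h : m ≤ n) : degreeLT d m ≤ degreeLT d n :=
  fun _ hp i hi ↦ hp i (h.trans hi)

theorem monomial_mem_degreeLT (i : ℕ) (a : A) : monomial d i a ∈ degreeLT d (i + 1) :=
  fun j hj ↦ by rw [coeff_monomial, if_neg (by lia)]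

theorem C_mem_degreeLT (a : A) : C d a ∈ degreeLT d (0 + 1) := monomial_mem_degreeLT 0 a

theorem exists_mem_degreeLT (p : SkewPolynomialRing d) : ∃ n, p ∈ degreeLT d n := by
  induction p using induction_on with
  | h0 => exact ⟨0, zero_mem _⟩
  | hadd p q hp hq =>
    obtain ⟨m, hm⟩ := hp
    obtain ⟨n, hn⟩ := hq
    exact ⟨max m n, add_mem (degreeLT_mono (le_max_left m n) hm)
      (degreeLT_mono (le_max_right m n) hn)⟩
  | hm i a => exact ⟨i + 1, monomial_mem_degreeLT i a⟩

theorem eq_zero_of_mem_degreeLT_zero {p : SkewPolynomialRing d} (hp : p ∈ degreeLT d 0) : p = 0 :=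
  ext fun i ↦ by rw [hp i (Nat.zero_le i), map_zero]

theorem mem_degreeLT_of_coeff_eq_zero {n : ℕ} {p : SkewPolynomialRing d}
    (hp : p ∈ degreeLT d (n + 1)) (h : coeff d n p = 0) : p ∈ degreeLT d n := by
  intro i hi
  rcases hi.eq_or_lt with rfl | hi
  · exact h
  · exact hp i hi

theorem exists_mem_degreeLT_succ_of_ne_zero {p : SkewPolynomialRing d} (hp : p ≠ 0) :
    ∃ n, p ∈ degreeLT d (n + 1) ∧ coeff d n p ≠ 0 := by
  obtain ⟨n, hn⟩ := exists_mem_degreeLT p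
  induction n with
  | zero => exact absurd (eq_zero_of_mem_degreeLT_zero hn) hp
  | succ n ih =>
    by_cases h : coeff d n p = 0
    · exact ih (mem_degreeLT_of_coeff_eq_zero hn h)
    · exact ⟨n, hn, h⟩

theorem eq_sum_monomial {n : ℕ} {p : SkewPolynomialRing d} (hp : p ∈ degreeLT d n) :
    p = ∑ i ∈ Finset.range n, monomial d i (coeff d i p) := by
  ext j
  simp only [map_sum, coeff_monomial, Finset.sum_ite_eq', Finset.mem_range]
  split_ifs with h
  · rfl
  · exact hp j (by lia)

theorem eq_C_of_mem_degreeLT_one {p : SkewPolynomialRing d} (hp : p ∈ degreeLT d (0 + 1)) :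
    p = C d (coeff d 0 p) :=
  (eq_sum_monomial hp).trans (Finset.sum_range_one _)

theorem xiMul_mem_degreeLT {n : ℕ} {p : SkewPolynomialRing d} (hp : p ∈ degreeLT d n) :
    xiMul d p ∈ degreeLT d (n + 1) := by
  intro i hi
  obtain ⟨i, rfl⟩ : ∃ j, i = j + 1 := ⟨i - 1, by lia⟩
  rw [coeff_xiMul_succ, hp i (by lia), hp (i + 1) (by lia), map_zero, add_zero]

theorem xiMul_pow_mem_degreeLT {n : ℕ} {p : SkewPolynomialRing d} (hp : p ∈ degreeLT d n)
    (i : ℕ) : (xiMul d ^ i) p ∈ degreeLT d (n + i) := by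
  induction i with
  | zero => exact hp
  | succ i ih => rw [pow_succ', Module.End.mul_apply]; exact xiMul_mem_degreeLT ih

theorem coeff_xiMul_pow {n : ℕ} {p : SkewPolynomialRing d} (hp : p ∈ degreeLT d (n + 1))
    (i : ℕ) : coeff d (n + i) ((xiMul d ^ i) p) = coeff d n p := by
  induction i with
  | zero => rfl
  | succ i ih =>
    rw [pow_succ', Module.End.mul_apply, ← add_assoc, coeff_xiMul_succ, ih,
      xiMul_pow_mem_degreeLT hp i _ (by lia), map_zero, add_zero]

theorem mul_eq_sum (p q : SkewPolynomialRing d) {n : ℕ} (hp : p ∈ degreeLT d n) :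
    p * q = ∑ i ∈ Finset.range n, coeff d i p • (xiMul d ^ i) q := by
  conv_lhs => rw [eq_sum_monomial hp]
  simp only [Finset.sum_mul, monomial_mul]

theorem coeff_mul {m n : ℕ} {p q : SkewPolynomialRing d} (hp : p ∈ degreeLT d (m + 1))
    (hq : q ∈ degreeLT d (n + 1)) : coeff d (m + n) (p * q) = coeff d m p * coeff d n q := by
  rw [mul_eq_sum p q hp, map_sum, Finset.sum_range_succ, Finset.sum_eq_zero, zero_add, coeff_smul,
    add_comm, coeff_xiMul_pow hq]
  intro i hi
  rw [Finset.mem_range] at hi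
  rw [coeff_smul, xiMul_pow_mem_degreeLT hq i _ (by lia), mul_zero]

instance [Nontrivial A] : Nontrivial (SkewPolynomialRing d) :=
  Function.Injective.nontrivial (f := C d) fun a b h ↦ by
    rw [← coeff_C_zero (d := d) a, h, coeff_C_zero]

instance [NoZeroDivisors A] : NoZeroDivisors (SkewPolynomialRing d) where
  eq_zero_or_eq_zero_of_mul_eq_zero {p q} h := by
    by_contra! hpq
    obtain ⟨m, hm, hm'⟩ := exists_mem_degreeLT_succ_of_ne_zero hpq.1
    obtain ⟨n, hn, hn'⟩ := exists_mem_degreeLT_succ_of_ne_zero hpq.2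
    have hmn := coeff_mul hm hn
    rw [h, map_zero] at hmn
    exact mul_ne_zero hm' hn' hmn.symm

instance [IsDomain A] : IsDomain (SkewPolynomialRing d) := NoZeroDivisors.to_isDomain _

end Degree

/-! ### The Hilbert basis theorem -/

section HilbertBasis

open scoped Polynomial

variable {k A : Type*} [CommRing k] [CommRing A] [Algebra k A] {d : Derivation k A A}
  {I J : Ideal (SkewPolynomialRing d)}

/-- The coefficients of `ξ ^ n` of the elements of degree at most `n` of a left ideal. -/
noncomputable def leadingIdeal (I : Ideal (SkewPolynomialRing d)) (n : ℕ) : Ideal A :=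
  (I.restrictScalars A ⊓ degreeLT d (n + 1)).map (coeff d n)

theorem leadingIdeal_mono (I : Ideal (SkewPolynomialRing d)) : Monotone (leadingIdeal I) := by
  refine monotone_nat_of_le_succ fun n ↦ ?_
  rintro _ ⟨p, ⟨hpI, hp⟩, rfl⟩
  refine ⟨xiMul d p, ⟨?_, xiMul_mem_degreeLT hp⟩, coeff_xiMul_pow hp 1⟩
  rw [← xi_mul]
  exact I.mul_mem_left _ hpI

/-- The ideal of leading forms of a left ideal, in the associated graded ring `A[X]` of
`A[ξ; 1, d]` for the filtration by degree. -/
noncomputable def leadingFormIdeal (I : Ideal (SkewPolynomialRing d)) : Ideal A[X] where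
  carrier := {f | ∀ n, f.coeff n ∈ leadingIdeal I n}
  zero_mem' _ := zero_mem _
  add_mem' hf hg n := by rw [Polynomial.coeff_add]; exact add_mem (hf n) (hg n)
  smul_mem' f g hg n := by
    rw [smul_eq_mul, Polynomial.coeff_mul]
    exact sum_mem fun ij hij ↦ Ideal.mul_mem_left _ _
      (leadingIdeal_mono I (Finset.HasAntidiagonal.antidiagonal.snd_le hij) (hg ij.2))

theorem monomial_mem_leadingFormIdeal {n : ℕ} {a : A} :
    Polynomial.monomial n a ∈ leadingFormIdeal I ↔ a ∈ leadingIdeal I n := by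
  refine ⟨fun h ↦ by simpa using h n, fun h m ↦ ?_⟩
  rw [Polynomial.coeff_monomial]
  split_ifs with hnm
  · exact hnm ▸ h
  · exact zero_mem _

theorem leadingFormIdeal_mono : Monotone (leadingFormIdeal (d := d)) := fun _ _ hIJ _ hf n ↦
  have ⟨p, ⟨hpI, hp⟩, hpf⟩ := hf n
  ⟨p, ⟨hIJ hpI, hp⟩, hpf⟩

theorem le_of_leadingFormIdeal_le (hJI : J ≤ I) (h : leadingFormIdeal I ≤ leadingFormIdeal J) :
    I ≤ J := by
  suffices ∀ n, ∀ p ∈ I, p ∈ degreeLT d n → p ∈ J by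
    intro p hp
    obtain ⟨n, hn⟩ := exists_mem_degreeLT p
    exact this n p hp hn
  intro n
  induction n with
  | zero =>
    intro p _ hp
    rw [eq_zero_of_mem_degreeLT_zero hp]
    exact J.zero_mem
  | succ n ih =>
    intro p hpI hp
    obtain ⟨q, ⟨hqJ, hq⟩, hqp⟩ : coeff d n p ∈ leadingIdeal J n :=
      monomial_mem_leadingFormIdeal.mp
        (h (monomial_mem_leadingFormIdeal.mpr ⟨p, ⟨hpI, hp⟩, rfl⟩))
    have hpq : p - q ∈ degreeLT d n :=
      mem_degreeLT_of_coeff_eq_zero (sub_mem hp hq) (by rw [map_sub, hqp, sub_self])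
    exact (J.sub_mem_iff_left hqJ).mp (ih _ (I.sub_mem hpI (hJI hqJ)) hpq)

theorem leadingFormIdeal_strictMono : StrictMono (leadingFormIdeal (d := d)) := fun _ _ h ↦
  lt_of_le_not_ge (leadingFormIdeal_mono h.le) fun h' ↦ h.not_ge (le_of_leadingFormIdeal_le h.le h')

instance [IsNoetherianRing A] : IsNoetherianRing (SkewPolynomialRing d) :=
  isNoetherian_iff'.mpr leadingFormIdeal_strictMono.wellFoundedGT

variable (d) in
/-- The surjection of `A[ξ; 1, -d]` onto the opposite of `A[ξ; 1, d]`, taking `ξ` to `ξ`. -/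
noncomputable def opHom : SkewPolynomialRing (-d) →ₐ[k] (SkewPolynomialRing d)ᵐᵒᵖ :=
  lift ((C d).toOpposite fun a b ↦ (Commute.all a b).map (C d)) (x := MulOpposite.op (xi d))
    fun a ↦ by
      change MulOpposite.op (C d a * xi d) = MulOpposite.op (xi d * C d a + C d (-d a))
      rw [xi_mul_C, map_neg, add_neg_cancel_right]

theorem opHom_surjective : Function.Surjective (opHom d) := fun p ↦ by
  change p ∈ (opHom d).range
  induction p using MulOpposite.rec' with | _ p
  induction p using induction_on with
  | h0 => exact zero_mem _
  | hadd p q hp hq => exact add_mem hp hq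
  | hm i a =>
    refine ⟨xi _ ^ i * C _ a, ?_⟩
    change opHom d _ = _
    rw [map_mul, map_pow, opHom, lift_xi, lift_C, ← C_mul_xi_pow, MulOpposite.op_mul,
      MulOpposite.op_pow]
    rfl

instance [IsNoetherianRing A] : IsNoetherianRing (SkewPolynomialRing d)ᵐᵒᵖ :=
  isNoetherianRing_of_surjective _ _ (opHom d).toRingHom opHom_surjective

end HilbertBasis

/-! ### The grading -/

section Grading

variable {k A : Type*} [CommRing k] [CommRing A] [Algebra k A] {d : Derivation k A A}
  {𝒜 : ℤ → Submodule k A} {m : ℤ}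

theorem monomial_mem_weightPiece {n : ℤ} {i : ℕ} {a : A} (ha : a ∈ 𝒜 (n - i * m)) :
    monomial d i a ∈ weightPiece d 𝒜 m n := by
  intro j
  rw [coeff_monomial]
  split_ifs with h
  · exact h ▸ ha
  · exact zero_mem _

theorem xiMul_mem_weightPiece (hd : ∀ n, ∀ a ∈ 𝒜 n, d a ∈ 𝒜 (n + m)) {n : ℤ}
    {p : SkewPolynomialRing d} (hp : p ∈ weightPiece d 𝒜 m n) :
    xiMul d p ∈ weightPiece d 𝒜 m (n + m) := by
  intro i
  have hdi : d (coeff d i p) ∈ 𝒜 (n + m - i * m) := by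
    simpa only [sub_add_eq_add_sub] using hd _ _ (hp i)
  cases i with
  | zero => rwa [coeff_xiMul_zero]
  | succ i =>
    rw [coeff_xiMul_succ]
    refine add_mem ?_ hdi
    convert hp i using 2
    push_cast
    ring

theorem xiMul_pow_mem_weightPiece (hd : ∀ n, ∀ a ∈ 𝒜 n, d a ∈ 𝒜 (n + m)) {n : ℤ}
    {p : SkewPolynomialRing d} (hp : p ∈ weightPiece d 𝒜 m n) (i : ℕ) :
    (xiMul d ^ i) p ∈ weightPiece d 𝒜 m (n + i * m) := by
  induction i with
  | zero => simpa using hp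
  | succ i ih =>
    rw [pow_succ', Module.End.mul_apply]
    convert xiMul_mem_weightPiece hd ih using 2
    push_cast
    ring

theorem smul_mem_weightPiece [SetLike.GradedMul 𝒜] {j n : ℤ} {a : A} (ha : a ∈ 𝒜 j)
    {p : SkewPolynomialRing d} (hp : p ∈ weightPiece d 𝒜 m n) :
    a • p ∈ weightPiece d 𝒜 m (j + n) := by
  intro i
  rw [coeff_smul, add_sub_assoc]
  exact SetLike.mul_mem_graded ha (hp i)

theorem gradedMonoid_weightPiece [SetLike.GradedMonoid 𝒜]
    (hd : ∀ n, ∀ a ∈ 𝒜 n, d a ∈ 𝒜 (n + m)) : SetLike.GradedMonoid (weightPiece d 𝒜 m) where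
  one_mem := monomial_mem_weightPiece (by simpa using SetLike.one_mem_graded 𝒜)
  mul_mem j n p q hp hq := by
    obtain ⟨N, hN⟩ := exists_mem_degreeLT p
    rw [mul_eq_sum p q hN]
    refine sum_mem fun i _ ↦ ?_
    convert smul_mem_weightPiece (hp i) (xiMul_pow_mem_weightPiece hd hq i) using 2
    ring

theorem iSupIndep_weightPiece (h : iSupIndep 𝒜) : iSupIndep (weightPiece d 𝒜 m) := by
  refine iSupIndep_def.mpr fun n ↦ Submodule.disjoint_def.mpr fun p hp hp' ↦ ext fun i ↦ ?_
  have hle : ⨆ j ≠ n, weightPiece d 𝒜 m j ≤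
      (⨆ j ≠ n - i * m, 𝒜 j).comap (coeff d i |>.restrictScalars k) :=
    iSup₂_le fun j hj q hq ↦
      Submodule.mem_iSup_of_mem (j - i * m)
        (Submodule.mem_iSup_of_mem (sub_left_injective.ne hj) (hq i))
  rw [map_zero]
  exact Submodule.disjoint_def.mp (iSupIndep_def.mp h _) _ (hp i) (hle hp')

theorem iSup_weightPiece (h : ⨆ n, 𝒜 n = ⊤) : ⨆ n, weightPiece d 𝒜 m n = ⊤ := by
  refine Submodule.eq_top_iff'.mpr fun p ↦ ?_
  induction p using induction_on with
  | h0 => exact zero_mem _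
  | hadd p q hp hq => exact add_mem hp hq
  | hm i a =>
    have ha : a ∈ ⨆ n, 𝒜 n := h ▸ Submodule.mem_top
    induction ha using Submodule.iSup_induction' with
    | mem n a ha =>
      refine Submodule.mem_iSup_of_mem (n + i * m) (monomial_mem_weightPiece ?_)
      rwa [add_sub_cancel_right]
    | zero => rw [monomial_zero]; exact zero_mem _
    | add a b _ _ ha hb => rw [monomial_add]; exact add_mem ha hb

theorem nonempty_gradedAlgebra_weightPiece [SetLike.GradedMonoid 𝒜] (hind : iSupIndep 𝒜)
    (hsup : ⨆ n, 𝒜 n = ⊤) (hd : ∀ n, ∀ a ∈ 𝒜 n, d a ∈ 𝒜 (n + m)) :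
    Nonempty (GradedAlgebra (weightPiece d 𝒜 m)) :=
  ⟨{ gradedMonoid_weightPiece hd with
    toDecomposition := (DirectSum.isInternal_submodule_of_iSupIndep_of_iSup_eq_top
      (iSupIndep_weightPiece hind) (iSup_weightPiece hsup)).chooseDecomposition }⟩

end Grading

/-! ### The action on the coefficient algebra -/

section Action

variable {k B : Type*} [CommRing k] [CommRing B] [Algebra k B]

/-- The action of `B[ξ; 1, d]` on `B` by differential operators: `B` acts by multiplication and
`ξ` by `d`. -/
noncomputable def action (d : Derivation k B B) : SkewPolynomialRing d →ₐ[k] Module.End k B :=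
  lift (Algebra.lmul k B) (x := (d : B →ₗ[k] B)) fun a ↦ LinearMap.ext fun b ↦ by
    change d (a * b) = a * d b + d a * b
    rw [Derivation.leibniz, smul_eq_mul, smul_eq_mul, mul_comm b]

theorem action_C (d : Derivation k B B) (a : B) : action d (C d a) = Algebra.lmul k B a :=
  lift_C _ _ a

theorem action_xi (d : Derivation k B B) : action d (xi d) = d := lift_xi _ _

variable {d : Derivation k B B}

theorem coeff_xiMul_pow_C (m : ℕ) (h : B) : coeff d m ((xiMul d ^ m) (C d h)) = h := by
  simpa only [zero_add, coeff_C_zero] using coeff_xiMul_pow (C_mem_degreeLT h) m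

theorem coeff_xiMul_pow_succ_C (m : ℕ) (h : B) :
    coeff d m ((xiMul d ^ (m + 1)) (C d h)) = (m + 1) • d h := by
  induction m with
  | zero => rw [zero_add, pow_one, coeff_xiMul_zero, coeff_C_zero, one_smul]
  | succ m ih =>
    rw [pow_succ', Module.End.mul_apply, coeff_xiMul_succ, ih, coeff_xiMul_pow_C,
      succ_nsmul _ (m + 1)]

theorem mul_C_sub_C_mul_mem_degreeLT {n : ℕ} {p : SkewPolynomialRing d}
    (hp : p ∈ degreeLT d (n + 1)) (h : B) : p * C d h - C d h * p ∈ degreeLT d n := by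
  refine mem_degreeLT_of_coeff_eq_zero (sub_mem ?_ ?_) ?_
  · rw [mul_eq_sum p _ hp]
    refine sum_mem fun i hi ↦ Submodule.smul_mem _ _ ?_
    rw [Finset.mem_range] at hi
    exact degreeLT_mono (by lia) (xiMul_pow_mem_degreeLT (C_mem_degreeLT h) i)
  · rw [C_mul]
    exact Submodule.smul_mem _ _ hp
  · have hpC := coeff_mul hp (C_mem_degreeLT h)
    rw [add_zero, coeff_C_zero] at hpC
    rw [map_sub, hpC, C_mul, coeff_smul, mul_comm, sub_self]

theorem coeff_mul_C_sub_C_mul {m : ℕ} {p : SkewPolynomialRing d}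
    (hp : p ∈ degreeLT d (m + 2)) (h : B) :
    coeff d m (p * C d h - C d h * p) = (m + 1) • (coeff d (m + 1) p * d h) := by
  rw [map_sub, mul_eq_sum p _ hp, map_sum, Finset.sum_range_succ, Finset.sum_range_succ,
    Finset.sum_eq_zero, coeff_smul, coeff_smul, coeff_xiMul_pow_succ_C, coeff_xiMul_pow_C, C_mul,
    coeff_smul, mul_smul_comm]
  · ring
  · intro i hi
    rw [Finset.mem_range] at hi
    rw [coeff_smul, xiMul_pow_mem_degreeLT (C_mem_degreeLT h) i _ (by lia), mul_zero]

theorem eq_zero_of_action_C_eq_zero {a : B} (h : action d (C d a) = 0) : a = 0 := by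
  rw [action_C] at h
  exact (mul_one a).symm.trans (LinearMap.congr_fun h 1)

theorem action_mul_C_sub_C_mul_eq_zero {p : SkewPolynomialRing d} (hp : action d p = 0) (h : B) :
    action d (p * C d h - C d h * p) = 0 := by
  rw [map_sub, map_mul, map_mul, hp, zero_mul, mul_zero, sub_zero]

/-- The commutator with `h` lowers the degree of a differential operator by exactly one, so a
nonzero element of the kernel of least degree would have degree zero. -/
theorem action_injective [IsAddTorsionFree B] {h : B} (hh : d h ∈ nonZeroDivisors B) :
    Function.Injective (action d) := by
  rw [injective_iff_map_eq_zero]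
  suffices ∀ n, ∀ p ∈ degreeLT d n, action d p = 0 → p = 0 by
    intro p hp
    obtain ⟨n, hn⟩ := exists_mem_degreeLT p
    exact this n p hn hp
  intro n
  induction n with
  | zero => exact fun p hp _ ↦ eq_zero_of_mem_degreeLT_zero hp
  | succ n ih =>
    intro p hp hp0
    cases n with
    | zero =>
      rw [eq_C_of_mem_degreeLT_one hp] at hp0 ⊢
      rw [eq_zero_of_action_C_eq_zero hp0, map_zero]
    | succ m =>
      have hcomm : p * C d h - C d h * p = 0 :=
        ih _ (mul_C_sub_C_mul_mem_degreeLT hp h) (action_mul_C_sub_C_mul_eq_zero hp0 h)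
      have hlead : (m + 1) • (coeff d (m + 1) p * d h) = 0 := by
        rw [← coeff_mul_C_sub_C_mul hp h, hcomm, map_zero]
      refine ih p (mem_degreeLT_of_coeff_eq_zero hp ?_) hp0
      exact (mul_right_mem_nonZeroDivisors_eq_zero_iff hh).mp
        ((nsmul_eq_zero_iff_right m.succ_ne_zero).mp hlead)

end Action

end SkewPolynomialRing

theorem isLeftOreDomain_of_isNoetherianRing {R : Type*} [Ring R] [IsDomain R]
    [IsNoetherianRing R] : IsLeftOreDomain R :=
  ⟨inferInstance, nonempty_oreSet_of_strongRankCondition⟩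

theorem iSupIndep_submodule_comap {ι R M N : Type*} [Ring R] [AddCommGroup M] [AddCommGroup N]
    [Module R M] [Module R N] {f : M →ₗ[R] N} (hf : Function.Injective f) {p : ι → Submodule R N}
    (hp : iSupIndep p) : iSupIndep fun i ↦ (p i).comap f := by
  refine iSupIndep_def.mpr fun i ↦ Submodule.disjoint_def.mpr fun x hx hx' ↦ ?_
  have hle : ⨆ j ≠ i, (p j).comap f ≤ (⨆ j ≠ i, p j).comap f :=
    iSup₂_le fun j hj ↦ Submodule.comap_mono (le_iSup₂_of_le j hj le_rfl)
  exact (map_eq_zero_iff f hf).mp (Submodule.disjoint_def.mp (iSupIndep_def.mp hp i) _ hx (hle hx'))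

section AlgebraicIndependence

open MvPolynomial

variable {R A : Type*} [CommRing R] [CommRing A] [Algebra R A]

theorem X_one_dvd_sub_aeval_X_zero (P : MvPolynomial (Fin 2) R) :
    X 1 ∣ P - Polynomial.aeval (X 0 : MvPolynomial (Fin 2) R)
      (aeval ![Polynomial.X, 0] P : Polynomial R) := by
  induction P using MvPolynomial.induction_on with
  | C c => simp
  | add p q hp hq =>
    simp only [map_add, add_sub_add_comm]
    exact dvd_add hp hq
  | mul_X p i hp =>
    fin_cases i
    · simp only [map_mul, aeval_X, Fin.zero_eta, Matrix.cons_val_zero, Polynomial.aeval_X,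
        ← sub_mul]
      exact hp.mul_right _
    · simp

variable {a b : A}

theorem X_one_dvd_of_aeval_pair_eq_zero
    (ha : ∀ p : Polynomial R, b ∣ Polynomial.aeval a p → p = 0) {P : MvPolynomial (Fin 2) R}
    (hP : aeval ![a, b] P = 0) : X 1 ∣ P := by
  obtain ⟨Q, hQ⟩ := X_one_dvd_sub_aeval_X_zero P
  have h := congrArg (aeval ![a, b]) hQ
  rw [map_sub, hP, zero_sub, map_mul, aeval_X, ← Polynomial.aeval_algHom_apply, aeval_X,
    neg_eq_iff_eq_neg, ← mul_neg] at h
  rw [ha _ (Dvd.intro _ h.symm), map_zero, sub_zero] at hQ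
  exact Dvd.intro Q hQ.symm

theorem aeval_pair_injective (hb : b ∈ nonZeroDivisors A)
    (ha : ∀ p : Polynomial R, b ∣ Polynomial.aeval a p → p = 0) :
    Function.Injective (aeval ![a, b] : MvPolynomial (Fin 2) R →ₐ[R] A) := by
  rw [injective_iff_map_eq_zero]
  intro P hP
  induction h : P.degreeOf 1 using Nat.strong_induction_on generalizing P with | _ n ih
  obtain ⟨Q, rfl⟩ := X_one_dvd_of_aeval_pair_eq_zero ha hP
  rw [map_mul, aeval_X] at hP
  by_contra hQ
  rw [mul_comm, (degreeOf_mul_X_eq_degreeOf_add_one_iff 1 Q).mpr (right_ne_zero_of_mul hQ)] at h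
  refine right_ne_zero_of_mul hQ (ih _ (by lia) Q ?_ rfl)
  exact (mul_left_mem_nonZeroDivisors_eq_zero_iff hb).mp hP

end AlgebraicIndependence

namespace MLDO

open UpperHalfPlane ModularForm EisensteinSeries

/-! ### The structure of the algebra of modular forms -/

theorem E₆_apply_I : E₆ UpperHalfPlane.I = 0 := by
  have hinv : (E₆ : ℍ → ℂ) ∣[(6 : ℤ)] ModularGroup.S = E₆ := E₆.slash_action_eq' _ ⟨_, rfl⟩
  have hS : ModularGroup.S • UpperHalfPlane.I = UpperHalfPlane.I := by
    ext
    rw [UpperHalfPlane.modular_S_smul]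
    simp
  have hI : Complex.I ^ (-6 : ℤ) = -1 := by
    rw [zpow_neg, show (6 : ℤ) = ((6 : ℕ) : ℤ) from rfl, zpow_natCast,
      show Complex.I ^ 6 = (Complex.I ^ 2) ^ 3 by ring]
    norm_num
  have h := congrFun hinv UpperHalfPlane.I
  rw [ModularForm.SL_slash_apply, hS, ModularGroup.denom_S, UpperHalfPlane.coe_I, hI,
    mul_neg_one] at h
  exact self_eq_neg.mp h.symm

theorem E₄_apply_I_ne_zero : E₄ UpperHalfPlane.I ≠ 0 := fun h ↦
  discriminant_ne_zero UpperHalfPlane.I (by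
    rw [discriminant_eq_E₄_cube_sub_E₆_sq, h, E₆_apply_I]
    norm_num)

/-- The linear map `f ↦ f(z) t ^ k` on modular forms of weight `k`: evaluation of `f`, as a
homogeneous function of lattices of degree `-k`, at a lattice similar to `ℤ + ℤ z`. -/
noncomputable def evalTwistForm (z : ℍ) (t : ℂ) (k : ℤ) : ModularForm 𝒮ℒ k →ₗ[ℂ] ℂ where
  toFun f := f z * t ^ k
  map_add' f g := by simp [add_mul]
  map_smul' c f := by simp [mul_assoc]

/-- The character of `ℳ` that is `f ↦ f(z) t ^ k` on modular forms `f` of weight `k`. -/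
noncomputable def evalTwist (z : ℍ) {t : ℂ} (ht : t ≠ 0) : ModularFormAlgebra →ₐ[ℂ] ℂ :=
  DirectSum.toAlgebra ℂ (fun k ↦ ModularForm 𝒮ℒ k) (evalTwistForm z t)
    (by
      change (1 : ℂ) * t ^ (0 : ℤ) = 1
      simp)
    (fun {i j} f g ↦ by
      change f z * g z * t ^ (i + j) = f z * t ^ i * (g z * t ^ j)
      rw [zpow_add₀ ht]
      ring)

theorem evalTwist_ofForm (z : ℍ) {t : ℂ} (ht : t ≠ 0) {k : ℤ} (f : ModularForm 𝒮ℒ k) :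
    evalTwist z ht (ofForm k f) = f z * t ^ k :=
  DirectSum.toModule_lof (φ := evalTwistForm z t) ℂ k f

theorem exists_algHom_formE₄_eq_formE₆_eq_zero {w : ℂ} (hw : w ≠ 0) :
    ∃ χ : ModularFormAlgebra →ₐ[ℂ] ℂ, χ formE₄ = w ∧ χ formE₆ = 0 := by
  obtain ⟨t, ht⟩ := IsAlgClosed.exists_pow_nat_eq (w / E₄ UpperHalfPlane.I) (n := 4) (by norm_num)
  have ht0 : t ≠ 0 := by
    rintro rfl
    rw [zero_pow (by norm_num)] at ht
    exact div_ne_zero hw E₄_apply_I_ne_zero ht.symm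
  refine ⟨evalTwist UpperHalfPlane.I ht0, ?_, ?_⟩
  · rw [formE₄, evalTwist_ofForm, show t ^ (4 : ℤ) = w / E₄ UpperHalfPlane.I from ht,
      mul_div_cancel₀ _ E₄_apply_I_ne_zero]
  · rw [formE₆, evalTwist_ofForm, E₆_apply_I, zero_mul]

theorem eq_zero_of_formE₆_dvd_aeval_formE₄ {p : Polynomial ℂ}
    (hp : formE₆ ∣ Polynomial.aeval formE₄ p) : p = 0 := by
  refine Polynomial.eq_zero_of_infinite_isRoot p
    ((Set.finite_singleton (0 : ℂ)).infinite_compl.mono fun w hw ↦ ?_)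
  obtain ⟨χ, h4, h6⟩ := exists_algHom_formE₄_eq_formE₆_eq_zero hw
  have hχ := map_dvd χ hp
  rwa [h6, zero_dvd_iff, ← Polynomial.aeval_algHom_apply, h4, Polynomial.coe_aeval_eq_eval] at hχ

theorem ofForm_mul_apply_add {k : ℤ} (f : ModularForm 𝒮ℒ k) (a : ModularFormAlgebra) (l : ℤ) :
    (ofForm k f * a) (k + l) = f.mul (a l) := by
  induction a using DirectSum.induction_on with
  | zero => rw [mul_zero]; exact (DFunLike.coe_injective (mul_zero (f : ℍ → ℂ))).symm
  | add a b ha hb =>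
    rw [mul_add, DirectSum.add_apply, ha, hb, DirectSum.add_apply]
    exact (DFunLike.coe_injective (mul_add (f : ℍ → ℂ) _ _)).symm
  | of j g =>
    change (ofForm k f * ofForm j g) (k + l) = _
    rw [ofForm_mul_ofForm]
    change DirectSum.of (fun k ↦ ModularForm 𝒮ℒ k) (k + j) (f.mul g) (k + l) = _
    rcases eq_or_ne l j with rfl | h
    · rw [DirectSum.of_eq_same, DirectSum.of_eq_same]
    · rw [DirectSum.of_eq_of_ne _ _ _ (by simpa using h), DirectSum.of_eq_of_ne _ _ _ h]
      exact (DFunLike.coe_injective (mul_zero (f : ℍ → ℂ))).symm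

theorem ofForm_mem_nonZeroDivisors {k : ℤ} {f : ModularForm 𝒮ℒ k} (hf : f ≠ 0) :
    ofForm k f ∈ nonZeroDivisors ModularFormAlgebra := by
  refine mem_nonZeroDivisors_iff_right.mpr fun a ha ↦ DFinsupp.ext fun l ↦ ?_
  by_contra hl
  refine ModularForm.mul_ne_zero ⟨1, one_mem_strictPeriods_SL, one_pos⟩ hf hl ?_
  rw [← ofForm_mul_apply_add, mul_comm, ha]
  rfl

theorem aeval_formE₄_formE₆_injective :
    Function.Injective (MvPolynomial.aeval ![formE₄, formE₆] :
      MvPolynomial (Fin 2) ℂ →ₐ[ℂ] ModularFormAlgebra) :=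
  aeval_pair_injective (ofForm_mem_nonZeroDivisors (EisensteinSeries.E_ne_zero _ ⟨3, rfl⟩))
    fun _ ↦ eq_zero_of_formE₆_dvd_aeval_formE₄

theorem ofForm_pow {k : ℤ} (f : ModularForm 𝒮ℒ k) (n : ℕ) :
    ofForm k f ^ n = ofForm (n * k) (f.pow n) :=
  ModularForm.directSum_of_pow f n

theorem formE₄_mem_adjoin : formE₄ ∈ Algebra.adjoin ℂ {formE₄, formE₆} :=
  Algebra.subset_adjoin (Set.mem_insert _ _)

theorem formE₆_mem_adjoin : formE₆ ∈ Algebra.adjoin ℂ {formE₄, formE₆} :=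
  Algebra.subset_adjoin (Set.mem_insert_of_mem _ rfl)

theorem ofForm_discriminant_mem_adjoin :
    ofForm 12 (CuspForm.discriminant : ModularForm 𝒮ℒ 12) ∈
      Algebra.adjoin ℂ {formE₄, formE₆} := by
  change DirectSum.of (ModularForm 𝒮ℒ) 12 CuspForm.discriminant ∈ _
  rw [discriminant_eq_E₄_cube_sub_E₆_sq_graded]
  exact Subalgebra.smul_mem _
    (sub_mem (pow_mem formE₄_mem_adjoin 3) (pow_mem formE₆_mem_adjoin 2)) _

theorem exists_eq_four_mul_add_six_mul {k : ℤ} (hk : 4 ≤ k) (hk2 : Even k) :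
    ∃ a b : ℕ, k = a * 4 + b * 6 := by
  obtain ⟨j, rfl⟩ := hk2
  rcases Int.even_or_odd j with ⟨i, rfl⟩ | ⟨i, rfl⟩
  · exact ⟨i.toNat, 0, by lia⟩
  · exact ⟨(i - 1).toNat, 1, by lia⟩

theorem qExpansion_E₄_pow_mul_E₆_pow_coeff_zero (a b : ℕ) :
    (qExpansion 1 ((E₄.pow a).mul (E₆.pow b))).coeff 0 = 1 := by
  rw [ModularForm.qExpansion_mul one_pos one_mem_strictPeriods_SL,
    ModularForm.qExpansion_pow one_pos one_mem_strictPeriods_SL,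
    ModularForm.qExpansion_pow one_pos one_mem_strictPeriods_SL,
    PowerSeries.coeff_zero_eq_constantCoeff_apply, map_mul, map_pow, map_pow,
    ← PowerSeries.coeff_zero_eq_constantCoeff_apply,
    ← PowerSeries.coeff_zero_eq_constantCoeff_apply,
    EisensteinSeries.E_qExpansion_coeff_zero _ ⟨2, rfl⟩,
    EisensteinSeries.E_qExpansion_coeff_zero _ ⟨3, rfl⟩, one_pow, one_pow, one_mul]

theorem exists_ofForm_eq_mul_add_smul {k : ℤ} (hk : 4 ≤ k) (hk2 : Even k)
    (f : ModularForm 𝒮ℒ k) : ∃ (g : ModularForm 𝒮ℒ (k - 12)) (c : ℂ) (a b : ℕ),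
      ofForm k f = ofForm 12 (CuspForm.discriminant : ModularForm 𝒮ℒ 12) * ofForm (k - 12) g +
        c • (formE₄ ^ a * formE₆ ^ b) := by
  obtain ⟨a, b, rfl⟩ := exists_eq_four_mul_add_six_mul hk hk2
  obtain ⟨F, hF⟩ := sub_smul_isCuspForm f _ (qExpansion_E₄_pow_mul_E₆_pow_coeff_zero a b)
  refine ⟨CuspForm.discriminantEquiv F, (qExpansion 1 f).coeff 0, a, b, ?_⟩
  rw [formE₄, formE₆, ofForm_pow, ofForm_pow, ofForm_mul_ofForm, ofForm_mul_ofForm,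
    ← sub_eq_iff_eq_add, ← map_smul, ← map_sub]
  refine (ofForm_eq_ofForm (by ring) _ _ ?_).symm
  rw [← hF]
  exact discriminant_mul_discriminantEquiv F

theorem ofForm_mem_adjoin (k : ℤ) (f : ModularForm 𝒮ℒ k) :
    ofForm k f ∈ Algebra.adjoin ℂ {formE₄, formE₆} := by
  induction h : k.toNat using Nat.strong_induction_on generalizing k with | _ n ih
  rcases lt_or_ge k 0 with hk | hk
  · rw [rank_zero_iff_forall_zero.mp (levelOne_neg_weight_rank_zero hk) f, map_zero]
    exact zero_mem _
  rcases Int.even_or_odd k with hk2 | hk2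
  swap
  · rw [levelOne_odd_weight_eq_zero hk2 f, map_zero]
    exact zero_mem _
  obtain rfl | rfl | hk4 : k = 0 ∨ k = 2 ∨ 4 ≤ k := by grind
  · obtain ⟨c, hc⟩ := ModularFormClass.levelOne_weight_zero_const f
    have hf : ofForm 0 f = algebraMap ℂ ModularFormAlgebra c :=
      congrArg (ofForm 0) (DFunLike.coe_injective hc : f = ModularForm.const c)
    rw [hf]
    exact Subalgebra.algebraMap_mem _ c
  · rw [rank_zero_iff_forall_zero.mp levelOne_weight_two_rank_zero f, map_zero]
    exact zero_mem _
  · obtain ⟨g, c, a, b, hf⟩ := exists_ofForm_eq_mul_add_smul hk4 hk2 f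
    rw [hf]
    exact add_mem (mul_mem ofForm_discriminant_mem_adjoin (ih _ (by lia) _ g rfl))
      (Subalgebra.smul_mem _
        (mul_mem (pow_mem formE₄_mem_adjoin a) (pow_mem formE₆_mem_adjoin b)) c)

theorem adjoin_formE₄_formE₆ : Algebra.adjoin ℂ {formE₄, formE₆} = ⊤ := by
  refine Algebra.eq_top_iff.mpr fun a ↦ ?_
  induction a using DirectSum.induction_on with
  | zero => exact zero_mem _
  | add a b ha hb => exact add_mem ha hb
  | of k f => exact ofForm_mem_adjoin k f

theorem aeval_formE₄_formE₆_bijective :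
    Function.Bijective (MvPolynomial.aeval ![formE₄, formE₆] :
      MvPolynomial (Fin 2) ℂ →ₐ[ℂ] ModularFormAlgebra) := by
  refine ⟨aeval_formE₄_formE₆_injective, AlgHom.range_eq_top _ |>.mp ?_⟩
  rw [← Algebra.adjoin_range_eq_range_aeval, Matrix.range_cons, Matrix.range_cons,
    Matrix.range_empty, Set.union_empty]
  exact adjoin_formE₄_formE₆

instance : IsNoetherianRing ModularFormAlgebra :=
  isNoetherianRing_of_surjective _ _ _ aeval_formE₄_formE₆_bijective.2

instance : IsDomain ModularFormAlgebra :=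
  (AlgEquiv.ofBijective _ aeval_formE₄_formE₆_bijective).symm.toMulEquiv.isDomain _

instance : SetLike.GradedMonoid formWeight where
  one_mem := ⟨1, rfl⟩
  mul_mem := by
    rintro k l _ _ ⟨f, rfl⟩ ⟨g, rfl⟩
    exact ⟨_, (ofForm_mul_ofForm f g).symm⟩

theorem iSupIndep_formWeight : iSupIndep formWeight := by
  refine iSupIndep_def.mpr fun k ↦ Submodule.disjoint_def.mpr ?_
  rintro _ ⟨f, rfl⟩ hf
  have hle : ⨆ l ≠ k, formWeight l ≤
      LinearMap.ker (DirectSum.component ℂ ℤ (fun k ↦ ModularForm 𝒮ℒ k) k) := by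
    refine iSup₂_le fun l hl ↦ ?_
    rintro _ ⟨g, rfl⟩
    exact DirectSum.of_eq_of_ne (β := fun k ↦ ModularForm 𝒮ℒ k) l k g hl.symm
  have hf0 : f = 0 := (DirectSum.of_eq_same (β := fun k ↦ ModularForm 𝒮ℒ k) k f).symm.trans (hle hf)
  rw [hf0, map_zero]

theorem iSup_formWeight : ⨆ k, formWeight k = ⊤ := DFinsupp.iSup_range_lsingle

theorem serreDerivation_ofForm (k : ℤ) (f : ModularForm 𝒮ℒ k) :
    serreDerivation (ofForm k f) = ofForm (k + 2) (serreForm k f) :=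
  serreLinear_ofForm k f

theorem serreDerivation_mem_formWeight (k : ℤ) :
    ∀ a ∈ formWeight k, serreDerivation a ∈ formWeight (k + 2) := by
  rintro _ ⟨f, rfl⟩
  exact ⟨_, (serreDerivation_ofForm k f).symm⟩

open SkewPolynomialRing

/-! ### The faithful action on `H` -/

theorem H.induction_on {P : H → Prop} (x : H) (zero : P 0) (add : ∀ x y, P x → P y → P (x + y))
    (of : ∀ n f, P (ofWeight n f)) : P x :=
  DirectSum.induction_on (motive := P) x zero of add

theorem end_ext {φ ψ : Module.End ℂ H} (h : ∀ n f, φ (ofWeight n f) = ψ (ofWeight n f)) :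
    φ = ψ := LinearMap.ext fun x ↦ by
  induction x using H.induction_on with
  | zero => simp
  | add x y hx hy => rw [map_add, map_add, hx, hy]
  | of n f => exact h n f

instance : IsAddTorsionFree H :=
  have : Module ℚ H := Module.compHom H (algebraMap ℚ ℂ)
  .of_module_rat H

theorem one_eq_ofWeight : (1 : H) = ofWeight 0 1 := rfl

theorem ofWeight_congr {n m : ℝ} (h : n = m) (f : Hol) : ofWeight n f = ofWeight m f := by rw [h]

/-- The component of weight `n` of an element of `H`. -/
noncomputable def weightComponent (n : ℝ) : H →ₗ[ℂ] Hol :=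
  (DirectSum.component ℂ ℝ (fun _ ↦ Hol) n : (⨁ _ : ℝ, Hol) →ₗ[ℂ] Hol)

theorem weightComponent_ofWeight (n : ℝ) (f : Hol) : weightComponent n (ofWeight n f) = f :=
  DirectSum.of_eq_same (β := fun _ : ℝ ↦ Hol) n f

theorem weightComponent_ofWeight_of_ne {n m : ℝ} (h : m ≠ n) (f : Hol) :
    weightComponent n (ofWeight m f) = 0 :=
  DirectSum.of_eq_of_ne (β := fun _ : ℝ ↦ Hol) m n f h.symm

theorem delta_ofWeight (n : ℝ) (f : Hol) :
    delta (ofWeight n f) = ofWeight (n + 2) (serreHol n f) :=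
  homogeneousEnd_ofWeight _ _ _ _

theorem serreHol_mul (n m : ℝ) (f g : Hol) :
    serreHol (n + m) (f * g) = f * serreHol m g + g * serreHol n f := by
  refine Subtype.ext ?_
  change Derivative.serreDerivative ((n + m : ℝ) : ℂ) (f.1 * g.1) =
    f.1 * Derivative.serreDerivative m g.1 + g.1 * Derivative.serreDerivative n f.1
  rw [Complex.ofReal_add, Derivative.serreDerivative_mul n m f.1 g.1 f.2 g.2]
  ring

theorem delta_leibniz (x y : H) : delta (x * y) = x • delta y + y • delta x := by
  simp only [smul_eq_mul]
  induction x using H.induction_on with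
  | zero => simp
  | add x x' hx hx' => simp only [add_mul, map_add, mul_add, hx, hx']; abel
  | of n f =>
    induction y using H.induction_on with
    | zero => simp
    | add y y' hy hy' => simp only [add_mul, map_add, mul_add, hy, hy']; abel
    | of m g =>
      rw [ofWeight_mul_ofWeight, delta_ofWeight, delta_ofWeight, delta_ofWeight,
        ofWeight_mul_ofWeight, ofWeight_mul_ofWeight, serreHol_mul, map_add,
        ofWeight_congr (by ring : n + (m + 2) = n + m + 2),
        ofWeight_congr (by ring : m + (n + 2) = n + m + 2)]

/-- The operator `δ` as a derivation of the algebra `H`. -/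
noncomputable def deltaDerivation : Derivation ℂ H H := Derivation.mk' delta delta_leibniz

/-- The coordinate function `z`, as an element of `Hol`. -/
def holCoordinate : Hol := ⟨fun z ↦ (z : ℂ), UpperHalfPlane.mdifferentiable_coe⟩

theorem serreHol_zero_holCoordinate :
    serreHol 0 holCoordinate = algebraMap ℂ Hol (2 * Real.pi * Complex.I)⁻¹ := by
  refine Subtype.ext (funext fun z ↦ ?_)
  change (2 * Real.pi * Complex.I : ℂ)⁻¹ *
      deriv ((fun z : ℍ ↦ (z : ℂ)) ∘ UpperHalfPlane.ofComplex) z -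
    ((0 : ℝ) : ℂ) * 12⁻¹ * EisensteinSeries.E2 z * z = (2 * Real.pi * Complex.I : ℂ)⁻¹
  rw [(UpperHalfPlane.eventuallyEq_coe_comp_ofComplex z.im_pos).deriv_eq]
  simp

theorem isUnit_deltaDerivation_holCoordinate :
    IsUnit (deltaDerivation (ofWeight 0 holCoordinate)) := by
  change IsUnit (delta (ofWeight 0 holCoordinate))
  rw [delta_ofWeight, serreHol_zero_holCoordinate]
  refine IsUnit.of_mul_eq_one (ofWeight (-2) (algebraMap ℂ Hol (2 * Real.pi * Complex.I))) ?_
  rw [ofWeight_mul_ofWeight, ← map_mul, inv_mul_cancel₀ Complex.two_pi_I_ne_zero, map_one,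
    one_eq_ofWeight]
  exact ofWeight_congr (by norm_num) 1

/-- The linear map `f ↦ (f, k)` from modular forms of weight `k` to `H`. -/
noncomputable def formToHLinear (k : ℤ) : ModularForm 𝒮ℒ k →ₗ[ℂ] H :=
  ofWeight k ∘ₗ
    { toFun := toHol
      map_add' := fun _ _ ↦ rfl
      map_smul' := fun _ _ ↦ rfl }

/-- The inclusion of `ℳ` into `H`, taking a modular form `f` of weight `k` to `(f, k)`. -/
noncomputable def formToH : ModularFormAlgebra →ₐ[ℂ] H :=
  DirectSum.toAlgebra ℂ (fun k ↦ ModularForm 𝒮ℒ k) formToHLinear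
    (ofWeight_congr Int.cast_zero _)
    (fun {i j} f g ↦ (ofWeight_congr (Int.cast_add i j) _).trans
      (ofWeight_mul_ofWeight i j (toHol f) (toHol g)).symm)

theorem formToH_ofForm (k : ℤ) (f : ModularForm 𝒮ℒ k) :
    formToH (ofForm k f) = ofWeight k (toHol f) :=
  DirectSum.toModule_lof (φ := formToHLinear) ℂ k f

theorem weightComponent_formToH (k : ℤ) (a : ModularFormAlgebra) :
    weightComponent k (formToH a) = toHol (a k) := by
  induction a using DirectSum.induction_on with
  | zero => rw [map_zero, map_zero]; rfl
  | add a b ha hb => rw [map_add, map_add, ha, hb]; rfl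
  | of l f =>
    change weightComponent k (formToH (ofForm l f)) = toHol (ofForm l f k)
    rw [formToH_ofForm]
    rcases eq_or_ne l k with rfl | h
    · rw [weightComponent_ofWeight]
      exact congrArg toHol (DirectSum.of_eq_same (β := fun k ↦ ModularForm 𝒮ℒ k) l f).symm
    · rw [weightComponent_ofWeight_of_ne (by exact_mod_cast h)]
      exact congrArg toHol (DirectSum.of_eq_of_ne (β := fun k ↦ ModularForm 𝒮ℒ k) l k f h.symm).symm

theorem toHol_injective {k : ℤ} : Function.Injective (toHol (k := k)) := fun _ _ h ↦
  DFunLike.coe_injective (congrArg Subtype.val h)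

theorem formToH_injective : Function.Injective formToH := fun a b h ↦
  DFinsupp.ext fun k ↦ toHol_injective (by
    rw [← weightComponent_formToH, h, weightComponent_formToH])

theorem formToH_serreDerivation (a : ModularFormAlgebra) :
    formToH (serreDerivation a) = deltaDerivation (formToH a) := by
  induction a using DirectSum.induction_on with
  | zero => simp
  | add a b ha hb => simp only [map_add, ha, hb]
  | of k f =>
    change formToH (serreDerivation (ofForm k f)) = delta (formToH (ofForm k f))
    rw [serreDerivation_ofForm, formToH_ofForm, formToH_ofForm, delta_ofWeight,
      ofWeight_congr (by push_cast; ring : ((k + 2 : ℤ) : ℝ) = k + 2)]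
    rfl

/-- The action of `ℳ[ξ; 1, δ]` on `H`, with `ℳ` acting by multiplication and `ξ` by `δ`. -/
noncomputable def mldoHom : SkewPolynomialRing serreDerivation →ₐ[ℂ] Module.End ℂ H :=
  (action deltaDerivation).comp (map formToH formToH_serreDerivation)

theorem mldoHom_injective : Function.Injective mldoHom :=
  (action_injective isUnit_deltaDerivation_holCoordinate.mem_nonZeroDivisors).comp
    (map_injective formToH formToH_serreDerivation formToH_injective)

theorem mldoHom_C (a : ModularFormAlgebra) :
    mldoHom (C _ a) = Algebra.lmul ℂ H (formToH a) := by
  rw [mldoHom, AlgHom.comp_apply, map_C, action_C]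

theorem mldoHom_xi : mldoHom (xi _) = delta := by
  rw [mldoHom, AlgHom.comp_apply, map_xi, action_xi]
  rfl

theorem mldoHom_C_ofForm (k : ℤ) (g : ModularForm 𝒮ℒ k) :
    mldoHom (C _ (ofForm k g)) = homogeneousEnd k fun _ ↦ LinearMap.mulLeft ℂ (toHol g) := by
  refine end_ext fun n f ↦ ?_
  rw [mldoHom_C, formToH_ofForm, homogeneousEnd_ofWeight, Algebra.coe_lmul_eq_mul,
    LinearMap.mul_apply', ofWeight_mul_ofWeight, LinearMap.mulLeft_apply]
  exact ofWeight_congr (add_comm _ _) _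

theorem mldoHom_C_formE₄ : mldoHom (C _ formE₄) = e₄ := by
  rw [formE₄, mldoHom_C_ofForm, Int.cast_ofNat, e₄]

theorem mldoHom_C_formE₆ : mldoHom (C _ formE₆) = e₆ := by
  rw [formE₆, mldoHom_C_ofForm, Int.cast_ofNat, e₆]

theorem adjoin_xi_formE₄_formE₆ :
    Algebra.adjoin ℂ {xi serreDerivation, C _ formE₄, C _ formE₆} = ⊤ := by
  refine eq_top_of_C_mem_of_xi_mem (fun a ↦ ?_) (Algebra.subset_adjoin (Set.mem_insert _ _))
  have ha : a ∈ Algebra.adjoin ℂ {formE₄, formE₆} := adjoin_formE₄_formE₆ ▸ Algebra.mem_top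
  have hCa : C serreDerivation a ∈
      (Algebra.adjoin ℂ {formE₄, formE₆}).map (C serreDerivation) := ⟨a, ha, rfl⟩
  rw [AlgHom.map_adjoin, Set.image_pair] at hCa
  exact Algebra.adjoin_mono (Set.subset_insert _ _) hCa

theorem range_mldoHom : mldoHom.range = mldoAlgebra := by
  rw [← Algebra.map_top, ← adjoin_xi_formE₄_formE₆, AlgHom.map_adjoin, Set.image_insert_eq,
    Set.image_pair, mldoHom_xi, mldoHom_C_formE₄, mldoHom_C_formE₆, mldoAlgebra]

/-- The isomorphism of `ℳ[ξ; 1, δ]` with the algebra `ℛ` given by the action on `H`. -/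
noncomputable def mldoEquiv : SkewPolynomialRing serreDerivation ≃ₐ[ℂ] mldoAlgebra :=
  (AlgEquiv.ofInjective mldoHom mldoHom_injective).trans (Subalgebra.equivOfEq _ _ range_mldoHom)

instance : IsNoetherianRing mldoAlgebra :=
  isNoetherianRing_of_ringEquiv _ mldoEquiv.toRingEquiv

instance : IsNoetherianRing mldoAlgebraᵐᵒᵖ :=
  isNoetherianRing_of_ringEquiv _ (RingEquiv.op mldoEquiv.toRingEquiv)

instance : IsDomain mldoAlgebra :=
  mldoEquiv.symm.toMulEquiv.isDomain _

/-! ### Weights of operators -/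

instance : SetLike.GradedMonoid endWeight where
  one_mem n f := ⟨f, ofWeight_congr (add_zero n) f⟩
  mul_mem i j φ ψ hφ hψ n f := by
    obtain ⟨g, hg⟩ := hψ n f
    obtain ⟨g', hg'⟩ := hφ (n + j) g
    exact ⟨g', by rw [Module.End.mul_apply, ← hg, ← hg']; exact ofWeight_congr (by ring) g'⟩

theorem homogeneousEnd_mem_endWeight (i : ℝ) (φ : ℝ → Hol →ₗ[ℂ] Hol) :
    homogeneousEnd i φ ∈ endWeight i := fun n f ↦ ⟨_, (homogeneousEnd_ofWeight i φ n f).symm⟩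

theorem iSupIndep_endWeight : iSupIndep endWeight := by
  refine iSupIndep_def.mpr fun i ↦ Submodule.disjoint_def.mpr fun φ hφ hφ' ↦ end_ext fun n f ↦ ?_
  have hle : ⨆ j ≠ i, endWeight j ≤
      LinearMap.ker (weightComponent (n + i) ∘ₗ LinearMap.applyₗ (ofWeight n f)) := by
    refine iSup₂_le fun j hj ψ hψ ↦ ?_
    obtain ⟨g, hg⟩ := hψ n f
    rw [LinearMap.mem_ker, LinearMap.comp_apply, LinearMap.applyₗ_apply_apply, ← hg,
      weightComponent_ofWeight_of_ne ((add_right_injective n).ne hj)]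
  have hzero : weightComponent (n + i) (φ (ofWeight n f)) = 0 := hle hφ'
  obtain ⟨g, hg⟩ := hφ n f
  rw [← hg, weightComponent_ofWeight] at hzero
  rw [← hg, hzero, map_zero, LinearMap.zero_apply]

theorem mldoHom_mem_endWeight {n : ℤ} {p : SkewPolynomialRing serreDerivation}
    (hp : p ∈ weightPiece serreDerivation formWeight 2 n) : mldoHom p ∈ endWeight n := by
  have hδ : delta ∈ endWeight 2 := homogeneousEnd_mem_endWeight 2 serreHol
  obtain ⟨N, hN⟩ := exists_mem_degreeLT p
  rw [eq_sum_monomial hN, map_sum]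
  refine sum_mem fun i _ ↦ ?_
  obtain ⟨f, hf⟩ := hp i
  rw [← C_mul_xi_pow, ← hf, map_mul, map_pow, mldoHom_C_ofForm, mldoHom_xi]
  convert SetLike.mul_mem_graded (homogeneousEnd_mem_endWeight _ _)
    (SetLike.pow_mem_graded i hδ) using 2
  push_cast
  ring

/-- The inclusion `≤` suffices: a family that spans and lies below an independent family is equal
to it. -/
theorem weightPiece_eq_comap_endWeight (n : ℤ) :
    weightPiece serreDerivation formWeight 2 n = (endWeight n).comap mldoHom.toLinearMap := by
  have hind : iSupIndep fun n : ℤ ↦ (endWeight n).comap mldoHom.toLinearMap :=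
    iSupIndep_submodule_comap mldoHom_injective (iSupIndep_endWeight.comp Int.cast_injective)
  exact congrFun ((hind.le_iff_eq_of_iSup_eq_top (iSup_weightPiece iSup_formWeight)).mp
    fun _ _ ↦ mldoHom_mem_endWeight) n

end MLDO

theorem mainTheorem4 :
    -- `ℳ` is the polynomial ring in `E₄` and `E₆`
    Function.Bijective
      (MvPolynomial.aeval ![MLDO.formE₄, MLDO.formE₆] :
        MvPolynomial (Fin 2) ℂ →ₐ[ℂ] MLDO.ModularFormAlgebra) ∧
    -- `ℳ[ξ; 1, δ]` is graded, with `ξ` of weight `2`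
    Nonempty (GradedAlgebra
      (SkewPolynomialRing.weightPiece MLDO.serreDerivation MLDO.formWeight 2)) ∧
    -- `ℳ[ξ; 1, δ]` is isomorphic to `ℛ`, as a graded algebra
    (∃ Φ : SkewPolynomialRing MLDO.serreDerivation ≃ₐ[ℂ] MLDO.mldoAlgebra,
      (Φ (SkewPolynomialRing.C _ MLDO.formE₄) : Module.End ℂ MLDO.H) = MLDO.e₄ ∧
      (Φ (SkewPolynomialRing.C _ MLDO.formE₆) : Module.End ℂ MLDO.H) = MLDO.e₆ ∧
      (Φ (SkewPolynomialRing.xi _) : Module.End ℂ MLDO.H) = MLDO.delta ∧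
      ∀ (n : ℤ) (p : SkewPolynomialRing MLDO.serreDerivation),
        p ∈ SkewPolynomialRing.weightPiece MLDO.serreDerivation MLDO.formWeight 2 n ↔
          Φ p ∈ MLDO.mldoWeight n) ∧
    -- `ℛ` is left and right Noetherian and a left and right Ore domain
    IsNoetherianRing MLDO.mldoAlgebra ∧
    IsNoetherianRing MLDO.mldoAlgebraᵐᵒᵖ ∧
    IsLeftOreDomain MLDO.mldoAlgebra ∧
    IsRightOreDomain MLDO.mldoAlgebra :=
  ⟨MLDO.aeval_formE₄_formE₆_bijective,
    SkewPolynomialRing.nonempty_gradedAlgebra_weightPiece MLDO.iSupIndep_formWeight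
      MLDO.iSup_formWeight MLDO.serreDerivation_mem_formWeight,
    ⟨MLDO.mldoEquiv, MLDO.mldoHom_C_formE₄, MLDO.mldoHom_C_formE₆, MLDO.mldoHom_xi,
      fun n ↦ SetLike.ext_iff.mp (MLDO.weightPiece_eq_comap_endWeight n)⟩,
    inferInstance, inferInstance, isLeftOreDomain_of_isNoetherianRing,
    isLeftOreDomain_of_isNoetherianRing⟩
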